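/- Let $n,p\ge 1$. There are $n$ agents and $p$ categories $D_1,\dots,D_p$ of items, with $D_i=\{1,\dots,n\}$; each agent $j$ has a linear order $R_j$ over the bundles in $D_1\times\cdots\times D_p$, and $\mathrm{Rank}(R_j,d)\in\{1,\dots,n^p\}$ is the position of the bundle $d$ in $R_j$ (the top position has rank $1$). A linear order $\mathcal O$ over the $np$ pairs (agent, category) determines a categorial sequential allocation mechanism (CSAM): in round $t$, if $(j,i)$ is the $t$-th pair of $\mathcal O$, agent $j$ chooses an item of $D_i$ that has not been chosen yet. The bundles available to agent $j$ in a round are those that contain the items she has chosen so far, and whose other items have not been chosen yet by anybody. Each agent is either optimistic or pessimistic: when agent $j$ chooses from $D_i$, if she is optimistic she chooses the item of category $i$ in her top-ranked available bundle; if she is pessimistic she chooses the available item $d\in D_i$ such that, for every other available item $d'\in D_i$, she prefers the worst available bundle whose $i$-th component is $d$ to the worst available bundle whose $i$-th component is $d'$. The worst-case utilitarian rank of a CSAM with given types of the agents is the maximum, over all preference profiles $(R_1,\dots,R_n)$, of the sum over the agents of the ranks of their allocated bundles; the worst-case egalitarian rank is the maximum over all profiles and all agents of the rank of the allocated bundle.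 The serial dictatorship with respect to a linear order $j_1\rhd\cdots\rhd j_n$ of the agents is the CSAM with the order $(j_1,1)\rhd\cdots\rhd(j_1,p)\rhd\cdots\rhd(j_n,1)\rhd\cdots\rhd(j_n,p)$. Then every serial dictatorship with all agents optimistic has worst-case utilitarian rank $$n(n^p+1)-\sum_{j=1}^n j^p,$$ which is the smallest worst-case utilitarian rank among all CSAMs with any combination of optimistic and pessimistic agents. It has worst-case egalitarian rank $n^p$, which is the largest worst-case egalitarian rank among all CSAMs with any combination of optimistic and pessimistic agents. -/

import Mathlib

/-- A bundle in `D_1 × ⋯ × D_p`, every category being `D_i = {1, …, n}`: one item per category. -/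
abbrev Bundle (n p : ℕ) : Type := Fin p → Fin n

/-- A preference: a linear order over the bundles, given by its strict part.
`R.1 b b'` means that the bundle `b` is preferred to the bundle `b'`. -/
abbrev Preference (n p : ℕ) : Type :=
  {r : Bundle n p → Bundle n p → Prop // IsStrictTotalOrder (Bundle n p) r}

/-- A preference profile: one linear order over the bundles for each of the `n` agents. -/
abbrev Profile (n p : ℕ) : Type := Fin n → Preference n p

/-- The rank of a bundle: the highest position has rank `1`, the lowest has rank `n ^ p`. -/
noncomputable def bundleRank {n p : ℕ} (R : Preference n p) (b : Bundle n p) : ℕ :=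
  {b' : Bundle n p | R.1 b' b}.ncard + 1

/-- The two types of myopic agents. -/
inductive AgentType : Type
  | optimistic
  | pessimistic

/-- A linear order over the (agent, category) pairs, as the bijection that sends the round `t` to
the `t`-th pair; it determines a categorial sequential allocation mechanism (CSAM). -/
abbrev CSAMOrder (n p : ℕ) : Type := Fin (n * p) ≃ Fin n × Fin p

namespace CSAM

variable {n p : ℕ}

/-- The items of category `i` that are available at the beginning of round `t`, when in the
earlier rounds every active agent `j'` chose the item `A j' i'` from the designated category `i'`.
(Only the entries of `A` that belong to rounds before `t` matter.) -/
def availableItems (O : CSAMOrder n p) (A : Fin n → Bundle n p) (t : Fin (n * p)) (i : Fin p) :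
    Set (Fin n) :=
  {d | ∀ j' : Fin n, O.symm (j', i) < t → A j' i ≠ d}

/-- The bundles that are available to agent `j` at the beginning of round `t`: they agree with the
items that `j` has chosen before, and consist of available items in the other categories. -/
def availableBundles (O : CSAMOrder n p) (A : Fin n → Bundle n p) (t : Fin (n * p)) (j : Fin n) :
    Set (Bundle n p) :=
  {b | ∀ i : Fin p, (O.symm (j, i) < t → b i = A j i) ∧
    (¬ O.symm (j, i) < t → b i ∈ availableItems O A t i)}

/-- `b` is the top-ranked bundle of the set `S`. -/
def IsTop (R : Preference n p) (S : Set (Bundle n p)) (b : Bundle n p) : Prop :=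
  b ∈ S ∧ ∀ b' ∈ S, b' ≠ b → R.1 b b'

/-- `b` is the bottom-ranked (worst) bundle of the set `S`. -/
def IsWorst (R : Preference n p) (S : Set (Bundle n p)) (b : Bundle n p) : Prop :=
  b ∈ S ∧ ∀ b' ∈ S, b' ≠ b → R.1 b' b

/-- `d` is the choice of an optimistic agent from category `i`, when `S` is the set of bundles that
are available to her: the item of category `i` in her top-ranked available bundle. -/
def IsOptimisticChoice (R : Preference n p) (S : Set (Bundle n p)) (i : Fin p) (d : Fin n) : Prop :=
  ∃ b, IsTop R S b ∧ b i = d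

/-- `d` is the choice of a pessimistic agent from category `i`, when `D` is the set of available
items of category `i` and `S` is the set of bundles that are available to her: for every other
available item `d'`, she prefers the worst available bundle with item `d` to the worst available
bundle with item `d'`. -/
def IsPessimisticChoice (R : Preference n p) (D : Set (Fin n)) (S : Set (Bundle n p)) (i : Fin p)
    (d : Fin n) : Prop :=
  d ∈ D ∧ ∀ d' ∈ D, d' ≠ d →
    ∃ b b', IsWorst R {c ∈ S | c i = d} b ∧ IsWorst R {c ∈ S | c i = d'} b' ∧ R.1 b b'

/-- `d` is the choice in round `t` of the active agent `j` from the designated category `i`,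
where `(j, i)` is the `t`-th pair of the order. -/
def IsChoice (O : CSAMOrder n p) (τ : Fin n → AgentType) (P : Profile n p)
    (A : Fin n → Bundle n p) (t : Fin (n * p)) (d : Fin n) : Prop :=
  match τ (O t).1 with
  | .optimistic => IsOptimisticChoice (P (O t).1) (availableBundles O A t (O t).1) (O t).2 d
  | .pessimistic => IsPessimisticChoice (P (O t).1) (availableItems O A t (O t).2)
      (availableBundles O A t (O t).1) (O t).2 d

/-- `A` is the result of the protocol: in each round the active agent makes her choice, given the
choices of all earlier rounds. -/
def IsOutcome (O : CSAMOrder n p) (τ : Fin n → AgentType) (P : Profile n p)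
    (A : Fin n → Bundle n p) : Prop :=
  ∀ t : Fin (n * p), IsChoice O τ P A t (A (O t).1 (O t).2)

/-! The protocol runs to its end and has exactly one result. -/

theorem availableItems_congr (O : CSAMOrder n p) {A B : Fin n → Bundle n p} {t : Fin (n * p)}
    (h : ∀ j i, O.symm (j, i) < t → A j i = B j i) (i : Fin p) :
    availableItems O A t i = availableItems O B t i := by
  ext d
  simp only [availableItems, Set.mem_ofPred_eq]
  exact forall_congr' fun j => forall_congr' fun hj => by rw [h j i hj]

theorem availableBundles_congr (O : CSAMOrder n p) {A B : Fin n → Bundle n p} {t : Fin (n * p)}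
    (h : ∀ j i, O.symm (j, i) < t → A j i = B j i) (j : Fin n) :
    availableBundles O A t j = availableBundles O B t j := by
  ext b
  simp only [availableBundles, Set.mem_ofPred_eq]
  refine forall_congr' fun i => ?_
  rw [availableItems_congr O h i]
  exact and_congr_left' (forall_congr' fun hj => by rw [h j i hj])

theorem isChoice_congr (O : CSAMOrder n p) (τ : Fin n → AgentType) (P : Profile n p)
    {A B : Fin n → Bundle n p} {t : Fin (n * p)}
    (h : ∀ j i, O.symm (j, i) < t → A j i = B j i) (d : Fin n) :
    IsChoice O τ P A t d ↔ IsChoice O τ P B t d := by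
  unfold IsChoice
  rw [availableItems_congr O h, availableBundles_congr O h]

theorem exists_isTop (R : Preference n p) {S : Set (Bundle n p)} (hS : S.Nonempty) :
    ∃ b, IsTop R S b := by
  have := R.2
  obtain ⟨b, hb, hmin⟩ := (Finite.wellFounded_of_trans_of_irrefl R.1).has_min S hS
  refine ⟨b, hb, fun b' hb' hne => ?_⟩
  rcases trichotomous_of R.1 b b' with h | h | h
  · exact h
  · exact absurd h.symm hne
  · exact absurd h (hmin b' hb')

theorem exists_isWorst (R : Preference n p) {S : Set (Bundle n p)} (hS : S.Nonempty) :
    ∃ b, IsWorst R S b := by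
  have := R.2
  obtain ⟨b, hb, hmin⟩ :=
    (Finite.wellFounded_of_trans_of_irrefl (Function.swap R.1)).has_min S hS
  refine ⟨b, hb, fun b' hb' hne => ?_⟩
  rcases trichotomous_of R.1 b b' with h | h | h
  · exact absurd h (hmin b' hb')
  · exact absurd h.symm hne
  · exact h

theorem IsTop.unique {R : Preference n p} {S : Set (Bundle n p)} {b c : Bundle n p}
    (hb : IsTop R S b) (hc : IsTop R S c) : b = c := by
  have := R.2
  by_contra hne
  exact asymm_of R.1 (hb.2 c hc.1 (Ne.symm hne)) (hc.2 b hb.1 hne)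

theorem IsWorst.unique {R : Preference n p} {S : Set (Bundle n p)} {b c : Bundle n p}
    (hb : IsWorst R S b) (hc : IsWorst R S c) : b = c := by
  have := R.2
  by_contra hne
  exact asymm_of R.1 (hb.2 c hc.1 (Ne.symm hne)) (hc.2 b hb.1 hne)

/-- In every category from which agent `j` has not yet chosen, some item is left. -/
theorem availableItems_nonempty (O : CSAMOrder n p) (A : Fin n → Bundle n p) (t : Fin (n * p))
    (j : Fin n) (i : Fin p) (h : ¬ O.symm (j, i) < t) : (availableItems O A t i).Nonempty := by
  classical
  by_contra hne
  rw [Set.not_nonempty_iff_eq_empty, Set.eq_empty_iff_forall_notMem] at hne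
  have hsub : (Finset.univ : Finset (Fin n)) ⊆ (Finset.univ.erase j).image (fun j' => A j' i) := by
    intro d _
    have hd := hne d
    simp only [availableItems, Set.mem_ofPred_eq, not_forall, not_not] at hd
    obtain ⟨j', hj', he⟩ := hd
    exact Finset.mem_image.2
      ⟨j', Finset.mem_erase.2 ⟨fun e => h (e ▸ hj'), Finset.mem_univ _⟩, he⟩
  have h1 := (Finset.card_le_card hsub).trans Finset.card_image_le
  rw [Finset.card_erase_of_mem (Finset.mem_univ j)] at h1
  have h2 : 0 < (Finset.univ : Finset (Fin n)).card := Finset.card_pos.2 ⟨j, Finset.mem_univ j⟩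
  omega

/-- Every available item of the designated category lies in some available bundle. -/
theorem exists_availableBundle (O : CSAMOrder n p) (A : Fin n → Bundle n p) (t : Fin (n * p))
    (d : Fin n) (hd : d ∈ availableItems O A t (O t).2) :
    {c ∈ availableBundles O A t (O t).1 | c (O t).2 = d}.Nonempty := by
  classical
  have key : ∀ i : Fin p, ∃ e : Fin n, ((O.symm ((O t).1, i) < t → e = A (O t).1 i) ∧
      (¬ O.symm ((O t).1, i) < t → e ∈ availableItems O A t i)) ∧ (i = (O t).2 → e = d) := by
    intro i
    by_cases hi : i = (O t).2
    · subst hi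
      exact ⟨d, ⟨fun h => absurd h (by simp), fun _ => hd⟩, fun _ => rfl⟩
    · by_cases hlt : O.symm ((O t).1, i) < t
      · exact ⟨A (O t).1 i, ⟨fun _ => rfl, fun h => absurd hlt h⟩, fun h => absurd h hi⟩
      · obtain ⟨e, he⟩ := availableItems_nonempty O A t _ i hlt
        exact ⟨e, ⟨fun h => absurd h hlt, fun _ => he⟩, fun h => absurd h hi⟩
  choose b hb using key
  exact ⟨b, fun i => (hb i).1, (hb _).2 rfl⟩

theorem exists_isChoice (O : CSAMOrder n p) (τ : Fin n → AgentType) (P : Profile n p)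
    (A : Fin n → Bundle n p) (t : Fin (n * p)) : ∃ d, IsChoice O τ P A t d := by
  obtain ⟨d₀, hd₀⟩ := availableItems_nonempty O A t (O t).1 (O t).2 (by simp)
  unfold IsChoice
  cases τ (O t).1 with
  | optimistic =>
    obtain ⟨c, hc⟩ := exists_availableBundle O A t d₀ hd₀
    obtain ⟨b, hb⟩ := exists_isTop (P (O t).1) ⟨c, hc.1⟩
    exact ⟨b (O t).2, b, hb, rfl⟩
  | pessimistic =>
    have hw : ∀ d ∈ availableItems O A t (O t).2, ∃ b, IsWorst (P (O t).1)
        {c ∈ availableBundles O A t (O t).1 | c (O t).2 = d} b := fun d hd =>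
      exists_isWorst _ (exists_availableBundle O A t d hd)
    obtain ⟨b, ⟨d, hd, hb⟩, htop⟩ := exists_isTop (P (O t).1)
      (S := {b | ∃ d ∈ availableItems O A t (O t).2, IsWorst (P (O t).1)
        {c ∈ availableBundles O A t (O t).1 | c (O t).2 = d} b})
      ⟨(hw d₀ hd₀).choose, d₀, hd₀, (hw d₀ hd₀).choose_spec⟩
    refine ⟨d, hd, fun d' hd' hne => ?_⟩
    obtain ⟨b', hb'⟩ := hw d' hd'
    refine ⟨b, b', hb, hb', htop b' ⟨d', hd', hb'⟩ fun e => hne ?_⟩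
    rw [← hb'.1.2, ← hb.1.2, e]

theorem IsChoice.unique {O : CSAMOrder n p} {τ : Fin n → AgentType} {P : Profile n p}
    {A : Fin n → Bundle n p} {t : Fin (n * p)} {d e : Fin n}
    (hd : IsChoice O τ P A t d) (he : IsChoice O τ P A t e) : d = e := by
  unfold IsChoice at hd he
  cases hτ : τ (O t).1 with
  | optimistic =>
    simp only [hτ] at hd he
    obtain ⟨b, hb, rfl⟩ := hd
    obtain ⟨c, hc, rfl⟩ := he
    rw [hb.unique hc]
  | pessimistic =>
    simp only [hτ] at hd he
    by_contra hne
    obtain ⟨b, b', hb, hb', hbb⟩ := hd.2 e he.1 (Ne.symm hne)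
    obtain ⟨c, c', hc, hc', hcc⟩ := he.2 d hd.1 hne
    rw [← hb'.unique hc, ← hb.unique hc'] at hcc
    have := (P (O t).1).2
    exact asymm_of (P (O t).1).1 hbb hcc

theorem existsUnique_isOutcome (O : CSAMOrder n p) (τ : Fin n → AgentType) (P : Profile n p) :
    ∃! A : Fin n → Bundle n p, IsOutcome O τ P A := by
  classical
  have hex : ∀ m : ℕ, ∃ A : Fin n → Bundle n p, ∀ t : Fin (n * p), t.1 < m →
      IsChoice O τ P A t (A (O t).1 (O t).2) := by
    intro m
    induction m with
    | zero => exact ⟨fun j _ => j, fun t ht => absurd ht (Nat.not_lt_zero _)⟩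
    | succ m ih =>
      obtain ⟨A, hA⟩ := ih
      by_cases hm : m < n * p
      · obtain ⟨d, hd⟩ := exists_isChoice O τ P A ⟨m, hm⟩
        let B : Fin n → Bundle n p := fun j i => if (j, i) = O ⟨m, hm⟩ then d else A j i
        have hAB : ∀ t : Fin (n * p), t.1 ≤ m → ∀ j i, O.symm (j, i) < t → A j i = B j i := by
          intro t ht j i hlt
          have hne : (j, i) ≠ O ⟨m, hm⟩ := by
            intro e
            rw [e, Equiv.symm_apply_apply, Fin.lt_def] at hlt
            exact absurd hlt (not_lt.2 ht)
          simp [B, hne]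
        refine ⟨B, fun t ht => ?_⟩
        rw [← isChoice_congr O τ P (hAB t (Nat.lt_succ_iff.1 ht))]
        by_cases htm : t = ⟨m, hm⟩
        · subst htm
          simpa [B] using hd
        · have hlt : t.1 < m := lt_of_le_of_ne (Nat.lt_succ_iff.1 ht) fun e => htm (Fin.ext e)
          have hne : O t ≠ O ⟨m, hm⟩ := fun e => htm (O.injective e)
          simpa [B, hne] using hA t hlt
      · exact ⟨A, fun t _ => hA t (lt_of_lt_of_le t.2 (not_lt.1 hm))⟩
  obtain ⟨A, hA⟩ := hex (n * p)
  refine ⟨A, fun t => hA t t.2, fun B hB => ?_⟩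
  have heq : ∀ m : ℕ, ∀ t : Fin (n * p), t.1 = m → B (O t).1 (O t).2 = A (O t).1 (O t).2 := by
    intro m
    induction m using Nat.strong_induction_on with
    | _ m ih =>
      intro t ht
      have hc : ∀ j i, O.symm (j, i) < t → B j i = A j i := by
        intro j i hlt
        have := ih (O.symm (j, i)).1 (ht ▸ hlt) (O.symm (j, i)) rfl
        simpa using this
      exact ((isChoice_congr O τ P hc _).1 (hB t)).unique (hA t t.2)
  funext j i
  simpa using heq _ (O.symm (j, i)) rfl

/-- The CSAM with order `O`, for agents of the types `τ`: it maps a profile to the allocation that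
results from the protocol. -/
noncomputable def allocation (O : CSAMOrder n p) (τ : Fin n → AgentType) (P : Profile n p) :
    Fin n → Bundle n p :=
  (existsUnique_isOutcome O τ P).choose

theorem allocation_isOutcome (O : CSAMOrder n p) (τ : Fin n → AgentType) (P : Profile n p) :
    IsOutcome O τ P (allocation O τ P) :=
  (existsUnique_isOutcome O τ P).choose_spec.1

end CSAM

instance Preference.instNonempty (n p : ℕ) : Nonempty (Preference n p) :=
  ⟨⟨WellOrderingRel, inferInstance⟩⟩

noncomputable instance Profile.instFintype (n p : ℕ) : Fintype (Profile n p) := Fintype.ofFinite _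

/-- The worst-case utilitarian rank: the maximum over all profiles of the sum of the ranks. -/
noncomputable def worstCaseUtilitarianRank {n p : ℕ} (O : CSAMOrder n p) (τ : Fin n → AgentType) :
    ℕ :=
  Finset.univ.sup' Finset.univ_nonempty fun P : Profile n p =>
    ∑ j, bundleRank (P j) (CSAM.allocation O τ P j)

/-- The worst-case egalitarian rank: the maximum over all profiles and all agents of the rank. -/
noncomputable def worstCaseEgalitarianRank {n p : ℕ} [NeZero n] (O : CSAMOrder n p)
    (τ : Fin n → AgentType) : ℕ :=
  Finset.univ.sup' Finset.univ_nonempty fun P : Profile n p =>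
    Finset.univ.sup' Finset.univ_nonempty fun j : Fin n =>
      bundleRank (P j) (CSAM.allocation O τ P j)

/-- The order of the serial dictatorship with respect to the linear order `K 0, K 1, …` of the
agents: first `K 0` chooses from the categories `1, …, p` in turn, then `K 1` does so, etc.
(`finProdFinEquiv.symm` sends `t` to the pair of quotient and remainder of `t` by `p`.) -/
def serialDictatorship {n p : ℕ} (K : Equiv.Perm (Fin n)) : CSAMOrder n p :=
  finProdFinEquiv.symm.trans (K.prodCongr (Equiv.refl (Fin p)))

/-! Lower bound, for any order `O` and any types: in `adverseProfile`, agent `j` receives the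
constant bundle `j` (`allocation_adverseProfile`). Let `k j i` be the number of items left in
category `i` when `j` chooses from it. Agent `j` prefers to the constant bundle every bundle outside
the product of her sets of remaining items, so her rank is at least `n ^ p + 1 - ∏ i, k j i`. In
each category the numbers `k j i` run through `1, …, n` (`sum_card_remaining_pow`), so AM-GM,
applied agent by agent, bounds `∑ j, ∏ i, k j i` by `∑ m ^ p` (`sum_prod_card_remaining_le`).

Upper bound, for an optimistic serial dictatorship: an agent with `m` predecessors gets her best
bundle out of a product of `p` sets of at least `n - m` items, so her rank is at most `n ^ p + 1 -
(n - m) ^ p` (`bundleRank_serialDictatorship_add_le`). Summing over the agents meets the lower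
bound.

For the egalitarian rank, `n ^ p` is a trivial upper bound, and the last dictator attains it in the
adverse profile, since one item is left to her in each category. -/

/-! ### Preferences given by keys, and bounds on ranks -/

/-- The preference that ranks bundles with a smaller value of `key` higher. -/
noncomputable def Preference.ofKey {n p : ℕ} (key : Bundle n p → ℕ) : Preference n p :=
  ⟨fun b c => key b < key c ∨ key b = key c ∧ WellOrderingRel b c,
    { trichotomous := by
        intro a b hab hba
        push Not at hab hba
        have h : key a = key b := le_antisymm hba.1 hab.1
        rcases trichotomous_of (WellOrderingRel (α := Bundle n p)) a b with h' | h' | h'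
        · exact absurd h' (hab.2 h)
        · exact h'
        · exact absurd h' (hba.2 h.symm)
      irrefl := by
        rintro a (h | ⟨-, h⟩)
        · exact lt_irrefl _ h
        · exact irrefl_of WellOrderingRel a h
      trans := by
        rintro a b c (h | ⟨h, h'⟩) (k | ⟨k, k'⟩)
        · exact Or.inl (h.trans k)
        · exact Or.inl (k ▸ h)
        · exact Or.inl (h ▸ k)
        · exact Or.inr ⟨h.trans k, trans_of WellOrderingRel h' k'⟩ }⟩

theorem Preference.ofKey_of_lt {n p : ℕ} {key : Bundle n p → ℕ} {b c : Bundle n p}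
    (h : key b < key c) : (Preference.ofKey key).1 b c := Or.inl h

theorem Preference.le_of_ofKey {n p : ℕ} {key : Bundle n p → ℕ} {b c : Bundle n p}
    (h : (Preference.ofKey key).1 b c) : key b ≤ key c :=
  h.elim le_of_lt fun h => h.1.le

theorem bundleRank_le {n p : ℕ} (R : Preference n p) (b : Bundle n p) :
    bundleRank R b ≤ n ^ p := by
  have := R.2
  have h : {b' : Bundle n p | R.1 b' b} ⊂ Set.univ :=
    (Set.ssubset_univ_iff).2 fun e =>
      irrefl_of R.1 b (by have : b ∈ {b' | R.1 b' b} := e ▸ Set.mem_univ b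
                          exact this)
  have h' := Set.ncard_lt_ncard h
  simpa [bundleRank, Set.ncard_univ] using h'

/-- If every bundle outside a set is preferred to `b`, then `b` has a high rank number. -/
theorem le_bundleRank_add_card {n p : ℕ} (R : Preference n p) (b : Bundle n p)
    (s : Finset (Bundle n p)) (h : ∀ c ∉ s, R.1 c b) :
    n ^ p + 1 ≤ bundleRank R b + s.card := by
  classical
  have h1 : ((sᶜ : Finset (Bundle n p)) : Set (Bundle n p)).ncard ≤
      {b' : Bundle n p | R.1 b' b}.ncard :=
    Set.ncard_le_ncard fun c hc => h c (by simpa using hc)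
  rw [Set.ncard_coe_finset] at h1
  have h2 := Finset.card_add_card_compl s
  simp only [Fintype.card_fun, Fintype.card_fin] at h2
  unfold bundleRank
  omega

/-- If `b` is the top of a set, then it has a low rank number. -/
theorem bundleRank_add_card_le {n p : ℕ} (R : Preference n p) (b : Bundle n p)
    (s : Finset (Bundle n p)) (h : CSAM.IsTop R s b) :
    bundleRank R b + s.card ≤ n ^ p + 1 := by
  classical
  have := R.2
  have h1 : {b' : Bundle n p | R.1 b' b}.ncard ≤
      ((sᶜ : Finset (Bundle n p)) : Set (Bundle n p)).ncard := by
    refine Set.ncard_le_ncard fun c hc => ?_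
    rw [Finset.mem_coe, Finset.mem_compl]
    intro hcs
    by_cases e : c = b
    · exact irrefl_of R.1 b (e ▸ hc)
    · exact asymm_of R.1 hc (h.2 c hcs e)
  rw [Set.ncard_coe_finset] at h1
  have h2 := Finset.card_add_card_compl s
  simp only [Fintype.card_fun, Fintype.card_fin] at h2
  unfold bundleRank
  omega

/-! ### The adverse profile of an arbitrary order -/

namespace CSAM

variable {n p : ℕ}

theorem IsOutcome.allocation_eq {O : CSAMOrder n p} {τ : Fin n → AgentType} {P : Profile n p}
    {A : Fin n → Bundle n p} (h : IsOutcome O τ P A) : allocation O τ P = A :=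
  (existsUnique_isOutcome O τ P).unique (allocation_isOutcome O τ P) h

/-- The items of category `i` left when `j` chooses from it, if every agent always chooses the
item of her own name. -/
def remaining (O : CSAMOrder n p) (j : Fin n) (i : Fin p) : Finset (Fin n) :=
  {d | O.symm (j, i) ≤ O.symm (d, i)}

/-- The key of the preference of agent `j` in a profile that is simultaneously worst for all
agents: bundles that use an item which is taken before `j` can choose it come first, with fewer
items different from `j` preferred; the others follow, the constant bundle `j` on top, and an
earlier first difference from it being worse. -/
def adverseKey (O : CSAMOrder n p) (j : Fin n) (b : Bundle n p) : ℕ :=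
  if b ∈ Fintype.piFinset (remaining O j) then
    -- The other branch takes values at most `p`, so the offset `p + 1` puts every bundle of the
    -- product below all the others. Each term of the supremum is positive, so the constant bundle
    -- is strictly best within the product.
    p + 1 + ({i | b i ≠ j} : Finset (Fin p)).sup fun i => n * p - (O.symm (j, i)).1
  else ({i | b i ≠ j} : Finset (Fin p)).card

noncomputable def adverseProfile (O : CSAMOrder n p) : Profile n p :=
  fun j => Preference.ofKey (adverseKey O j)

theorem const_mem_remaining (O : CSAMOrder n p) (j : Fin n) :
    (fun _ => j) ∈ Fintype.piFinset (remaining O j) := by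
  simp [remaining]

theorem adverseKey_const (O : CSAMOrder n p) (j : Fin n) :
    adverseKey O j (fun _ => j) = p + 1 := by
  rw [adverseKey, if_pos (const_mem_remaining O j)]
  simp

theorem adverseKey_le_of_notMem {O : CSAMOrder n p} {j : Fin n} {b : Bundle n p}
    (h : b ∉ Fintype.piFinset (remaining O j)) : adverseKey O j b ≤ p := by
  rw [adverseKey, if_neg h]
  exact (Finset.card_le_univ _).trans (by simp)

theorem le_adverseKey_of_mem {O : CSAMOrder n p} {j : Fin n} {b : Bundle n p}
    (h : b ∈ Fintype.piFinset (remaining O j)) : p + 1 ≤ adverseKey O j b := by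
  rw [adverseKey, if_pos h]
  exact Nat.le_add_right _ _

theorem mem_availableItems_const (O : CSAMOrder n p) (t : Fin (n * p)) (i : Fin p) (d : Fin n) :
    d ∈ availableItems O (fun j _ => j) t i ↔ t ≤ O.symm (d, i) := by
  simp only [availableItems, Set.mem_ofPred_eq]
  refine ⟨fun h => not_lt.1 fun h' => h d h' rfl, fun h j' hj' e => ?_⟩
  subst e
  exact absurd hj' (not_lt.2 h)

theorem const_mem_availableBundles (O : CSAMOrder n p) (t : Fin (n * p)) (j : Fin n) :
    (fun _ => j) ∈ availableBundles O (fun j _ => j) t j := fun i =>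
  ⟨fun _ => rfl, fun h => (mem_availableItems_const O t i j).2 (not_lt.1 h)⟩

theorem update_mem_availableBundles {O : CSAMOrder n p} {j d : Fin n} {i : Fin p}
    {b : Bundle n p} (hb : b ∈ availableBundles O (fun j _ => j) (O.symm (j, i)) j)
    (hd : O.symm (j, i) ≤ O.symm (d, i)) :
    Function.update b i d ∈ availableBundles O (fun j _ => j) (O.symm (j, i)) j := by
  intro i'
  by_cases h : i' = i
  · subst h
    exact ⟨fun h => absurd h (lt_irrefl _), fun _ => by
      rw [Function.update_self]; exact (mem_availableItems_const O _ _ _).2 hd⟩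
  · rw [Function.update_of_ne h]
    exact hb i'

/-- The top available bundle is either the constant one or one that uses an item taken before `j`
can get it. In the latter case a component other than `j` in category `i` is not the unattainable
one, so replacing it by `j` would improve the bundle. -/
theorem isOptimisticChoice_adverseProfile (O : CSAMOrder n p) (j : Fin n) (i : Fin p) :
    IsOptimisticChoice (adverseProfile O j)
      (availableBundles O (fun j _ => j) (O.symm (j, i)) j) i j := by
  have := (adverseProfile O j).2
  obtain ⟨b, hb⟩ := exists_isTop (adverseProfile O j)
    ⟨_, const_mem_availableBundles O (O.symm (j, i)) j⟩
  refine ⟨b, hb, ?_⟩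
  have hmin : ∀ c ∈ availableBundles O (fun j _ => j) (O.symm (j, i)) j,
      adverseKey O j b ≤ adverseKey O j c := by
    intro c hc
    by_cases e : c = b
    · rw [e]
    · exact Preference.le_of_ofKey (hb.2 c hc e)
  by_contra hne
  by_cases hS : b ∈ Fintype.piFinset (remaining O j)
  · have h := hmin _ (const_mem_availableBundles O _ j)
    rw [adverseKey_const, adverseKey, if_pos hS] at h
    have h1 : n * p - (O.symm (j, i)).1 ≤
        ({i | b i ≠ j} : Finset (Fin p)).sup fun i => n * p - (O.symm (j, i)).1 :=
      Finset.le_sup (f := fun i => n * p - (O.symm (j, i)).1) (by simpa using hne)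
    have h2 := (O.symm (j, i)).2
    omega
  · have hi : b i ∈ remaining O j i := by
      have := (hb.1 i).2 (lt_irrefl _)
      rw [mem_availableItems_const] at this
      simpa [remaining] using this
    -- The component that leaves the product lies in a category other than `i`, so it survives the
    -- update.
    have hS' : Function.update b i j ∉ Fintype.piFinset (remaining O j) := by
      simp only [Fintype.mem_piFinset, not_forall] at hS ⊢
      obtain ⟨i', hi'⟩ := hS
      refine ⟨i', ?_⟩
      rwa [Function.update_of_ne]
      rintro rfl
      exact hi' hi
    have h := hmin _ (update_mem_availableBundles hb.1 le_rfl)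
    rw [adverseKey, adverseKey, if_neg hS, if_neg hS'] at h
    refine absurd h (not_le.2 (Finset.card_lt_card ?_))
    rw [Finset.ssubset_iff_of_subset]
    · exact ⟨i, by simpa using hne, by simp⟩
    · intro i' hi'
      simp only [Finset.mem_filter, Finset.mem_univ, true_and] at hi' ⊢
      by_cases e : i' = i
      · rw [e]; exact hne
      · rwa [Function.update_of_ne e] at hi'

/-- Choosing `d ≠ j` now admits a bundle of the product whose first difference from `j` is in the
current round; after choosing `j`, any difference comes in a later round and costs less. -/
theorem isPessimisticChoice_adverseProfile (O : CSAMOrder n p) (j : Fin n) (i : Fin p) :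
    IsPessimisticChoice (adverseProfile O j)
      (availableItems O (fun j _ => j) (O.symm (j, i)) i)
      (availableBundles O (fun j _ => j) (O.symm (j, i)) j) i j := by
  have := (adverseProfile O j).2
  refine ⟨(mem_availableItems_const O _ _ _).2 le_rfl, fun d hd hdj => ?_⟩
  rw [mem_availableItems_const] at hd
  obtain ⟨b, hb⟩ := exists_isWorst (adverseProfile O j)
    (S := {c ∈ availableBundles O (fun j _ => j) (O.symm (j, i)) j | c i = j})
    ⟨_, const_mem_availableBundles O _ j, rfl⟩
  -- This bundle need not be the worst with item `d`; it is enough that it is already worse than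
  -- `b`.
  have hw : Function.update (fun _ => j) i d ∈
      {c ∈ availableBundles O (fun j _ => j) (O.symm (j, i)) j | c i = d} :=
    ⟨update_mem_availableBundles (const_mem_availableBundles O _ j) hd, Function.update_self ..⟩
  obtain ⟨b', hb'⟩ := exists_isWorst (adverseProfile O j) ⟨_, hw⟩
  refine ⟨b, b', hb, hb', ?_⟩
  have hwS : Function.update (fun _ => j) i d ∈ Fintype.piFinset (remaining O j) := by
    rw [Fintype.mem_piFinset]
    intro i'
    by_cases e : i' = i
    · subst e
      simpa [remaining] using hd
    · rw [Function.update_of_ne e]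
      simp [remaining]
  have hlt : adverseKey O j b < adverseKey O j (Function.update (fun _ => j) i d) := by
    by_cases hS : b ∈ Fintype.piFinset (remaining O j)
    · rw [adverseKey, adverseKey, if_pos hS, if_pos hwS]
      have h1 : n * p - (O.symm (j, i)).1 ≤
          ({i' | Function.update (fun _ => j) i d i' ≠ j} : Finset (Fin p)).sup
            fun i => n * p - (O.symm (j, i)).1 :=
        Finset.le_sup (f := fun i => n * p - (O.symm (j, i)).1) (by simpa using hdj)
      have hpos : 0 < n * p - (O.symm (j, i)).1 := Nat.sub_pos_of_lt (O.symm (j, i)).2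
      refine Nat.add_lt_add_left (lt_of_lt_of_le ((Finset.sup_lt_iff hpos).2 ?_) h1) _
      intro i' hi'
      simp only [Finset.mem_filter, Finset.mem_univ, true_and] at hi'
      -- In the categories chosen earlier, an available bundle already agrees with `j`.
      have h2 : O.symm (j, i) ≤ O.symm (j, i') := not_lt.1 fun h => hi' ((hb.1.1 i').1 h)
      have h3 : O.symm (j, i) ≠ O.symm (j, i') := by
        intro e
        have := O.symm.injective e
        simp only [Prod.mk.injEq, true_and] at this
        exact hi' (this ▸ hb.1.2)
      have h4 : (O.symm (j, i)).1 < (O.symm (j, i')).1 := Fin.lt_def.1 (lt_of_le_of_ne h2 h3)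
      omega
    · exact lt_of_le_of_lt (adverseKey_le_of_notMem hS)
        (Nat.lt_of_succ_le (le_adverseKey_of_mem hwS))
  have hbw := Preference.ofKey_of_lt hlt
  by_cases e : Function.update (fun _ => j) i d = b'
  · exact e ▸ hbw
  · exact trans_of (adverseProfile O j).1 hbw (hb'.2 _ hw e)

/-- For the adverse profile, every agent receives the bundle of the items of her own name,
whatever the types of the agents are. -/
theorem allocation_adverseProfile (O : CSAMOrder n p) (τ : Fin n → AgentType) :
    allocation O τ (adverseProfile O) = fun j _ => j := by
  refine IsOutcome.allocation_eq fun t => ?_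
  obtain ⟨⟨j, i⟩, rfl⟩ := O.symm.surjective t
  unfold IsChoice
  rw [Equiv.apply_symm_apply]
  cases τ j with
  | optimistic => exact isOptimisticChoice_adverseProfile O j i
  | pessimistic => exact isPessimisticChoice_adverseProfile O j i

theorem le_bundleRank_adverseProfile (O : CSAMOrder n p) (τ : Fin n → AgentType) (j : Fin n) :
    n ^ p + 1 ≤ bundleRank (adverseProfile O j) (allocation O τ (adverseProfile O) j) +
      ∏ i, (remaining O j i).card := by
  rw [allocation_adverseProfile, ← Fintype.card_piFinset]
  refine le_bundleRank_add_card _ _ _ fun c hc => Preference.ofKey_of_lt ?_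
  rw [adverseKey_const]
  exact Nat.lt_succ_of_le (adverseKey_le_of_notMem hc)

/-! ### Counting the remaining items, and the lower bound -/

/-- The numbers of items that the `n` agents find in a category are `1, …, n` in some order. -/
theorem sum_card_remaining_pow (O : CSAMOrder n p) (i : Fin p) (q : ℕ) :
    ∑ j, (remaining O j i).card ^ q = ∑ m ∈ Finset.Icc 1 n, m ^ q := by
  have hanti : ∀ j j', O.symm (j, i) < O.symm (j', i) →
      (remaining O j' i).card < (remaining O j i).card := by
    intro j j' h
    refine Finset.card_lt_card ((Finset.ssubset_iff_of_subset ?_).2 ⟨j, ?_, ?_⟩)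
    · intro d hd
      simp only [remaining, Finset.mem_filter, Finset.mem_univ, true_and] at hd ⊢
      exact h.le.trans hd
    · simp [remaining]
    · simpa [remaining] using h
  have hinj : Function.Injective fun j => (remaining O j i).card := by
    intro j j' h
    rcases lt_trichotomy (O.symm (j, i)) (O.symm (j', i)) with hlt | heq | hlt
    · exact absurd h (hanti _ _ hlt).ne'
    · exact (Prod.mk.inj (O.symm.injective heq)).1
    · exact absurd h (hanti _ _ hlt).ne
  have himg : Finset.univ.image (fun j => (remaining O j i).card) = Finset.Icc 1 n := by
    refine Finset.eq_of_subset_of_card_le (fun m hm => ?_) ?_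
    · obtain ⟨j, -, rfl⟩ := Finset.mem_image.1 hm
      refine Finset.mem_Icc.2 ⟨Finset.card_pos.2 ⟨j, by simp [remaining]⟩, ?_⟩
      exact (Finset.card_le_univ _).trans (by simp)
    · rw [Finset.card_image_of_injective _ hinj]
      simp
  rw [← himg, Finset.sum_image fun a _ b _ h => hinj h]

end CSAM

/-- The inequality of arithmetic and geometric means for natural numbers, without division. -/
theorem mul_prod_le_sum_pow {p : ℕ} (hp : 1 ≤ p) (k : Fin p → ℕ) :
    p * ∏ i, k i ≤ ∑ i, k i ^ p := by
  have hp0 : (p : ℝ) ≠ 0 := by positivity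
  -- With weights `1 / p` and entries `k i ^ p`, the geometric mean is `∏ i, k i`.
  have h := Real.geom_mean_le_arith_mean_weighted Finset.univ (fun _ : Fin p => (p : ℝ)⁻¹)
    (fun i => (k i : ℝ) ^ p) (fun _ _ => by positivity) (by simp [hp0])
    (fun _ _ => by positivity)
  rw [← Finset.mul_sum, Finset.prod_congr rfl fun i _ =>
    Real.pow_rpow_inv_natCast (Nat.cast_nonneg (k i)) (by omega), inv_mul_eq_div,
    le_div_iff₀' (by positivity)] at h
  exact_mod_cast h

theorem CSAM.sum_prod_card_remaining_le {n p : ℕ} (hp : 1 ≤ p) (O : CSAMOrder n p) :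
    ∑ j, ∏ i, (remaining O j i).card ≤ ∑ m ∈ Finset.Icc 1 n, m ^ p := by
  refine Nat.le_of_mul_le_mul_left ?_ hp
  calc p * ∑ j, ∏ i, (remaining O j i).card
      = ∑ j, p * ∏ i, (remaining O j i).card := Finset.mul_sum ..
    _ ≤ ∑ j, ∑ i, (remaining O j i).card ^ p :=
        Finset.sum_le_sum fun j _ => mul_prod_le_sum_pow hp _
    _ = ∑ i, ∑ j, (remaining O j i).card ^ p := Finset.sum_comm
    _ = p * ∑ m ∈ Finset.Icc 1 n, m ^ p := by simp [sum_card_remaining_pow]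

/-- The additive form avoids truncated subtraction in `ℕ`. -/
theorem le_worstCaseUtilitarianRank_add {n p : ℕ} (hp : 1 ≤ p) (O : CSAMOrder n p)
    (τ : Fin n → AgentType) :
    n * (n ^ p + 1) ≤ worstCaseUtilitarianRank O τ + ∑ m ∈ Finset.Icc 1 n, m ^ p := by
  calc n * (n ^ p + 1) = ∑ _j : Fin n, (n ^ p + 1) := by simp
    _ ≤ ∑ j, (bundleRank (CSAM.adverseProfile O j)
          (CSAM.allocation O τ (CSAM.adverseProfile O) j) +
          ∏ i, (CSAM.remaining O j i).card) :=
        Finset.sum_le_sum fun j _ => CSAM.le_bundleRank_adverseProfile O τ j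
    _ ≤ _ := by
        rw [Finset.sum_add_distrib]
        exact Nat.add_le_add
          (Finset.le_sup' (fun P : Profile n p => ∑ j, bundleRank (P j) (CSAM.allocation O τ P j))
            (Finset.mem_univ _))
          (CSAM.sum_prod_card_remaining_le hp O)

/-! ### Optimistic serial dictatorships: the upper bound -/

theorem serialDictatorship_symm_lt_iff {n p : ℕ} (K : Equiv.Perm (Fin n)) (j j' : Fin n)
    (i i' : Fin p) :
    (serialDictatorship K).symm (j', i') < (serialDictatorship K).symm (j, i) ↔
      K.symm j' < K.symm j ∨ K.symm j' = K.symm j ∧ i' < i := by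
  have hval : ∀ (j : Fin n) (i : Fin p),
      ((serialDictatorship K).symm (j, i)).1 = i.1 + p * (K.symm j).1 := fun _ _ => rfl
  rw [Fin.lt_def, hval, hval, Fin.lt_def, Fin.lt_def, Fin.ext_iff]
  have hi := i.2
  have hi' := i'.2
  rcases lt_trichotomy (K.symm j').1 (K.symm j).1 with h | h | h
  · have : p * ((K.symm j').1 + 1) ≤ p * (K.symm j).1 := Nat.mul_le_mul_left p h
    rw [Nat.mul_add] at this
    constructor <;> intro _ <;> omega
  · rw [h]
    omega
  · have : p * ((K.symm j).1 + 1) ≤ p * (K.symm j').1 := Nat.mul_le_mul_left p h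
    rw [Nat.mul_add] at this
    constructor <;> intro _ <;> omega

theorem CSAM.card_remaining_serialDictatorship {n p : ℕ} (K : Equiv.Perm (Fin n)) (j : Fin n)
    (i : Fin p) : (remaining (serialDictatorship K) j i).card = n - (K.symm j).1 := by
  have h : remaining (serialDictatorship K) j i =
      (Finset.Ici (K.symm j)).map K.toEmbedding := by
    ext d
    simp only [remaining, Finset.mem_filter, Finset.mem_univ, true_and]
    rw [← not_lt, serialDictatorship_symm_lt_iff, Finset.mem_map_equiv]
    simp
  rw [h, Finset.card_map, Fin.card_Ici]

/-- In a serial dictatorship, an optimistic agent receives the best bundle of the items that the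
earlier agents have left. -/
theorem bundleRank_serialDictatorship_add_le {n p : ℕ} (K : Equiv.Perm (Fin n)) (P : Profile n p)
    (j : Fin n) :
    bundleRank (P j)
        (CSAM.allocation (serialDictatorship K) (fun _ => AgentType.optimistic) P j) +
      (n - (K.symm j).1) ^ p ≤ n ^ p + 1 := by
  classical
  set A := CSAM.allocation (serialDictatorship K) (fun _ => AgentType.optimistic) P
  have hout : CSAM.IsOutcome (serialDictatorship K) (fun _ => AgentType.optimistic) P A :=
    CSAM.allocation_isOutcome _ _ _
  let taken : Fin p → Finset (Fin n) := fun i =>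
    (Finset.Iio (K.symm j)).image fun m => A (K m) i
  have htaken : ∀ i d, d ∈ (taken i)ᶜ ↔ ∀ j', K.symm j' < K.symm j → A j' i ≠ d := by
    intro i d
    simp only [taken, Finset.mem_compl, Finset.mem_image, Finset.mem_Iio, not_exists, not_and]
    exact ⟨fun h j' hj' => by simpa using h (K.symm j') hj', fun h m hm => h (K m) (by simpa)⟩
  -- An inequality suffices here, so it is not needed that earlier agents chose distinct items.
  have hcard : ∀ i, n - (K.symm j).1 ≤ ((taken i)ᶜ).card := by
    intro i
    have h1 : (taken i).card ≤ (K.symm j).1 := by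
      simpa using (Finset.card_image_le : (taken i).card ≤ _)
    rw [Finset.card_compl, Fintype.card_fin]
    omega
  let S : Finset (Bundle n p) := Fintype.piFinset fun i => (taken i)ᶜ
  have hScard : (n - (K.symm j).1) ^ p ≤ S.card := by
    rw [Fintype.card_piFinset]
    simpa using Finset.prod_le_prod' (s := Finset.univ) fun i _ => hcard i
  have hpos : 0 < (n - (K.symm j).1) ^ p := pow_pos (Nat.sub_pos_of_lt (K.symm j).2) p
  obtain ⟨b, hb⟩ := CSAM.exists_isTop (P j) (S := (S : Set (Bundle n p)))
    (Finset.card_pos.1 (hpos.trans_le hScard))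
  -- While `j` makes her choices nobody else moves, so her available bundles are those of `S` that
  -- agree with `b` so far. Since `b` is among them, it stays on top.
  have hAb : ∀ m : ℕ, ∀ i : Fin p, i.1 = m → A j i = b i := by
    intro m
    induction m using Nat.strong_induction_on with
    | _ m ih =>
      intro i hi
      have hprev : ∀ i' < i, A j i' = b i' := fun i' h => ih i'.1 (hi ▸ h) i' rfl
      have hmem : ∀ c, c ∈ CSAM.availableBundles (serialDictatorship K) A
          ((serialDictatorship K).symm (j, i)) j ↔ c ∈ S ∧ ∀ i' < i, c i' = b i' := by
        intro c
        simp only [CSAM.availableBundles, CSAM.availableItems, Set.mem_ofPred_eq,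
          serialDictatorship_symm_lt_iff, lt_irrefl, true_and, false_or]
        simp only [S, Fintype.mem_piFinset]
        constructor
        · intro h
          have h1 : ∀ i' < i, c i' = b i' := fun i' h' => ((h i').1 h').trans (hprev i' h')
          refine ⟨fun i' => ?_, h1⟩
          by_cases h' : i' < i
          · rw [h1 i' h']
            exact Fintype.mem_piFinset.1 hb.1 i'
          · exact (htaken _ _).2 fun j' hj' e => ((h i').2 h') j' (Or.inl hj') e
        · rintro ⟨h1, h2⟩ i'
          refine ⟨fun h' => (h2 i' h').trans (hprev i' h').symm, fun h' j' hj' => ?_⟩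
          exact (htaken _ _).1 (h1 i') j' (hj'.resolve_right fun h => h' h.2)
      have hc := hout ((serialDictatorship K).symm (j, i))
      unfold CSAM.IsChoice at hc
      rw [Equiv.apply_symm_apply] at hc
      obtain ⟨c, hc, hci⟩ := hc
      have hbtop : CSAM.IsTop (P j) (CSAM.availableBundles (serialDictatorship K) A
          ((serialDictatorship K).symm (j, i)) j) b :=
        ⟨(hmem b).2 ⟨hb.1, fun _ _ => rfl⟩, fun b' hb' => hb.2 b' ((hmem b').1 hb').1⟩
      rw [hbtop.unique hc]
      exact hci.symm
  have hAj : A j = b := funext fun i => hAb i.1 i rfl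
  rw [hAj]
  exact (Nat.add_le_add_left hScard _).trans (bundleRank_add_card_le (P j) b S hb)

theorem sum_sub_symm_pow {n : ℕ} (p : ℕ) (K : Equiv.Perm (Fin n)) :
    ∑ j, (n - (K.symm j).1) ^ p = ∑ m ∈ Finset.Icc 1 n, m ^ p := by
  -- The numbers `n - K.symm j` are the counts of remaining items in a serial dictatorship with a
  -- single category; the exponent `p` is independent of that.
  rw [← CSAM.sum_card_remaining_pow (serialDictatorship (p := 1) K) 0 p]
  simp_rw [CSAM.card_remaining_serialDictatorship]

theorem worstCaseUtilitarianRank_serialDictatorship_add_le {n p : ℕ} (K : Equiv.Perm (Fin n)) :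
    worstCaseUtilitarianRank (serialDictatorship (p := p) K) (fun _ => AgentType.optimistic) +
      ∑ m ∈ Finset.Icc 1 n, m ^ p ≤ n * (n ^ p + 1) := by
  obtain ⟨P, -, hP⟩ := Finset.exists_mem_eq_sup' Finset.univ_nonempty fun P : Profile n p =>
    ∑ j, bundleRank (P j)
      (CSAM.allocation (serialDictatorship K) (fun _ => AgentType.optimistic) P j)
  rw [worstCaseUtilitarianRank, hP, ← sum_sub_symm_pow p K, ← Finset.sum_add_distrib]
  calc _ ≤ ∑ _j : Fin n, (n ^ p + 1) :=
        Finset.sum_le_sum fun j _ => bundleRank_serialDictatorship_add_le K P j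
    _ = _ := by simp

/-! ### The egalitarian rank and the conclusion -/

theorem worstCaseEgalitarianRank_le {n p : ℕ} [NeZero n] (O : CSAMOrder n p)
    (τ : Fin n → AgentType) : worstCaseEgalitarianRank O τ ≤ n ^ p :=
  Finset.sup'_le _ _ fun P _ => Finset.sup'_le _ _ fun _ _ => bundleRank_le (P _) _

theorem le_worstCaseEgalitarianRank_serialDictatorship {n p : ℕ} [NeZero n]
    (K : Equiv.Perm (Fin n)) (τ : Fin n → AgentType) :
    n ^ p ≤ worstCaseEgalitarianRank (serialDictatorship (p := p) K) τ := by
  have hn : 0 < n := NeZero.pos n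
  -- The last agent in the order `K`: her product of remaining items is a single bundle.
  let j : Fin n := K ⟨n - 1, by omega⟩
  have h := CSAM.le_bundleRank_adverseProfile (serialDictatorship (p := p) K) τ j
  have hj : n - (K.symm j).1 = 1 := by
    simp only [j, Equiv.symm_apply_apply]
    omega
  simp_rw [CSAM.card_remaining_serialDictatorship, hj] at h
  rw [Finset.prod_const_one] at h
  refine (Nat.le_of_succ_le_succ h).trans ?_
  exact (Finset.le_sup' (fun j : Fin n => bundleRank
      (CSAM.adverseProfile (serialDictatorship (p := p) K) j) (CSAM.allocation
        (serialDictatorship K) τ (CSAM.adverseProfile (serialDictatorship K)) j))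
      (Finset.mem_univ j)).trans
    (Finset.le_sup' (fun P : Profile n p => Finset.univ.sup' Finset.univ_nonempty fun j : Fin n =>
      bundleRank (P j) (CSAM.allocation (serialDictatorship K) τ P j)) (Finset.mem_univ _))

theorem proposition2 (n p : ℕ) [NeZero n] (hp : 1 ≤ p) (K : Equiv.Perm (Fin n)) :
    ((worstCaseUtilitarianRank (serialDictatorship (p := p) K)
        (fun _ => AgentType.optimistic) : ℕ) : ℤ) =
      (n : ℤ) * ((n : ℤ) ^ p + 1) - ∑ j ∈ Finset.Icc 1 n, (j : ℤ) ^ p ∧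
    (∀ (O : CSAMOrder n p) (τ : Fin n → AgentType),
      worstCaseUtilitarianRank (serialDictatorship (p := p) K) (fun _ => AgentType.optimistic) ≤
        worstCaseUtilitarianRank O τ) ∧
    worstCaseEgalitarianRank (serialDictatorship (p := p) K) (fun _ => AgentType.optimistic) =
      n ^ p ∧
    (∀ (O : CSAMOrder n p) (τ : Fin n → AgentType),
      worstCaseEgalitarianRank O τ ≤
        worstCaseEgalitarianRank (serialDictatorship (p := p) K)
          (fun _ => AgentType.optimistic)) := by
  have hU := worstCaseUtilitarianRank_serialDictatorship_add_le (p := p) K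
  refine ⟨?_, fun O τ => ?_, ?_, fun O τ => ?_⟩
  · have h := le_antisymm hU (le_worstCaseUtilitarianRank_add hp _ _)
    rw [eq_sub_iff_add_eq]
    exact_mod_cast h
  · exact Nat.le_of_add_le_add_right (hU.trans (le_worstCaseUtilitarianRank_add hp O τ))
  · exact le_antisymm (worstCaseEgalitarianRank_le _ _)
      (le_worstCaseEgalitarianRank_serialDictatorship K _)
  · exact (worstCaseEgalitarianRank_le O τ).trans
      (le_worstCaseEgalitarianRank_serialDictatorship K _)
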